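/- Let $f$ be one of the functions $\ln, \sin, \cos, \tan, \csc, \sec, \cot, \sinh, \cosh, \tanh, \coth$ of a complex variable, where $\ln$ may be any determination of the complex logarithm on $\mathbb{C}\setminus\{0\}$, that is, any function with $e^{\ln z}=z$ for all $z\neq 0$. Let $g, h_1, h_2\in\mathbb{Q}[x]$. Suppose that $\alpha\in\mathbb{C}$, $\alpha\neq 0$, is a solution of the equation $h_1(x)\,f(g(x))=h_2(x)$ (in particular $f$ is defined at $g(\alpha)$), and that $h_1(\alpha)$, $g(\alpha)$, $f(g(\alpha))$ and $h_2(\alpha)$ are all nonzero. Then $\alpha$ is transcendental, i.e. not a root of any nonzero polynomial with rational coefficients. -/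

import Mathlib

/-- The complex cosecant `1 / sin z`, for `sin z ≠ 0` (the value at a pole is set to `0`). -/
noncomputable def cscFun (z : ℂ) : ℂ := 1 / Complex.sin z

/-- The complex secant `1 / cos z`, for `cos z ≠ 0` (the value at a pole is set to `0`). -/
noncomputable def secFun (z : ℂ) : ℂ := 1 / Complex.cos z

/-- The complex hyperbolic cotangent `cosh z / sinh z`, for `sinh z ≠ 0` (the value at a pole is
set to `0`). -/
noncomputable def cothFun (z : ℂ) : ℂ := Complex.cosh z / Complex.sinh z

/-- `L` is a determination of the complex logarithm on the nonzero complex numbers: `L z` is, for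
every `z ≠ 0`, one of the solutions `w` of `exp w = z`. The principal branch is an instance, and
every branch on a smaller domain (in particular the real logarithm on the positive half-line) is
the restriction of an instance. -/
def IsLogarithm (L : ℂ → ℂ) : Prop := ∀ z : ℂ, z ≠ 0 → Complex.exp (L z) = z

/-- The functions `ln, sin, cos, tan, csc, sec, cot, sinh, cosh, tanh, coth` of a complex variable,
with any determination of the logarithm. The six functions that have poles take the value
`0` at their poles, so a nonzero value is always a value at a point of the natural domain. -/
inductive IsListedFunction : (ℂ → ℂ) → Prop
  | ln (L : ℂ → ℂ) (hL : IsLogarithm L) : IsListedFunction L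
  | sin : IsListedFunction Complex.sin
  | cos : IsListedFunction Complex.cos
  | tan : IsListedFunction Complex.tan
  | csc : IsListedFunction cscFun
  | sec : IsListedFunction secFun
  | cot : IsListedFunction Complex.cot
  | sinh : IsListedFunction Complex.sinh
  | cosh : IsListedFunction Complex.cosh
  | tanh : IsListedFunction Complex.tanh
  | coth : IsListedFunction cothFun

/-! If `α` were algebraic, then so would be `b = g(α)` and `f(b) = h₂(α)/h₁(α)`, both nonzero. For a
logarithm, `f(b)` is then a nonzero algebraic number with algebraic exponential `b`; for the other
functions, algebraic identities make `exp (b * I)` or `exp b` algebraic. Both contradict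
Hermite–Lindemann (`Complex.transcendental_exp`). That theorem excludes integer relations `∑ c_x e^x
= 0` over a Galois number field. Multiplying conjugate relations makes `c` Galois invariant with `c
0 ≠ 0`. Hermite's simultaneous approximations to the `e^x` then yield an integer that is nonzero
modulo a large prime `p` but of absolute value below 1. -/

/-! ### Hermite's argument for invariant relations -/

open Polynomial in
/-- A finite set of nonzero algebraic numbers consists of roots of an integer polynomial with
nonzero constant coefficient. -/
theorem exists_int_polynomial_forall_aeval_eq_zero {K : Type*} [Field K] [NumberField K]
    (s : Finset K) (hs : ∀ x ∈ s, x ≠ 0) :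
    ∃ f : ℤ[X], f.eval 0 ≠ 0 ∧ ∀ x ∈ s, aeval x f = 0 := by
  have key : ∀ x : K, ∃ q : ℤ[X], x ≠ 0 → q.coeff 0 ≠ 0 ∧ aeval x q = 0 := by
    intro x
    by_cases hx : x = 0
    · exact ⟨0, fun h => absurd hx h⟩
    · have halg : IsAlgebraic ℤ x :=
        (IsFractionRing.isAlgebraic_iff ℤ ℚ K).mpr (Algebra.IsAlgebraic.isAlgebraic x)
      obtain ⟨q, h0, h1⟩ :=
        halg.exists_nonzero_coeff_and_aeval_eq_zero (mem_nonZeroDivisors_of_ne_zero hx)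
      exact ⟨q, fun _ => ⟨h0, h1⟩⟩
  choose q hq using key
  refine ⟨∏ x ∈ s, q x, ?_, fun x hx => ?_⟩
  · rw [eval_prod, Finset.prod_ne_zero_iff]
    intro x hx
    rw [← coeff_zero_eq_eval_zero]
    exact (hq x (hs x hx)).1
  · rw [map_prod]
    exact Finset.prod_eq_zero hx (hq x (hs x hx)).2

open Polynomial in
/-- If `N * x` is integral, then so is `N ^ m * g(x)` for integer polynomials `g` of degree at most
`m`. -/
theorem isIntegral_pow_mul_aeval {K : Type*} [Field K] {x : K} {N : ℤ}
    (hx : IsIntegral ℤ ((N : K) * x)) {m : ℕ} (g : ℤ[X]) (hg : g.natDegree ≤ m) :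
    IsIntegral ℤ ((N : K) ^ m * aeval x g) := by
  have hN (z : ℤ) : IsIntegral ℤ (z : K) := isIntegral_algebraMap (R := ℤ) (x := z)
  rw [aeval_eq_sum_range' (Nat.lt_succ_of_le hg), Finset.mul_sum]
  refine IsIntegral.sum _ fun i hi => ?_
  have hi : i ≤ m := Nat.lt_succ_iff.mp (Finset.mem_range.mp hi)
  have : (N : K) ^ m * (g.coeff i • x ^ i) =
      (g.coeff i : K) * ((N : K) ^ (m - i) * ((N : K) * x) ^ i) := by
    rw [mul_pow, ← mul_assoc ((N : K) ^ (m - i)), ← pow_add, Nat.sub_add_cancel hi, zsmul_eq_mul]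
    ring
  rw [this]
  exact (hN _).mul (((hN N).pow _).mul (hx.pow i))

/-- An algebraic integer fixed by the Galois group is an integer. -/
theorem exists_int_eq_of_isIntegral_of_fixed {K : Type*} [Field K] [NumberField K] [IsGalois ℚ K]
    {x : K} (hx : IsIntegral ℤ x) (hfix : ∀ σ : K ≃ₐ[ℚ] K, σ x = x) : ∃ m : ℤ, (m : K) = x := by
  obtain ⟨r, rfl⟩ := (IsGalois.mem_range_algebraMap_iff_fixed (F := ℚ) x).mpr hfix
  have hr : IsIntegral ℤ r :=
    (isIntegral_algebraMap_iff (algebraMap ℚ K).injective).mp hx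
  obtain ⟨m, rfl⟩ := IsIntegrallyClosed.isIntegral_iff.mp hr
  exact ⟨m, by simp⟩

/-- For all large `n`, a multiple of `a ^ (n + 1)` is smaller than `n!`. -/
theorem eventually_mul_pow_succ_div_factorial_lt_one (b a : ℝ) :
    ∀ᶠ n : ℕ in Filter.atTop, b * (a ^ (n + 1) / (n.factorial : ℝ)) < 1 := by
  have h := (FloorSemiring.tendsto_pow_div_factorial_atTop a).const_mul (b * a)
  rw [mul_zero] at h
  filter_upwards [h.eventually (gt_mem_nhds zero_lt_one)] with n hn
  calc b * (a ^ (n + 1) / (n.factorial : ℝ)) = b * a * (a ^ n / (n.factorial : ℝ)) := by ring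
    _ < 1 := hn

open Polynomial in
/-- The Galois invariant case of the Lindemann–Weierstrass theorem. -/
theorem sum_mul_exp_ne_zero_of_invariant {K : Type*} [Field K] [NumberField K] [IsGalois ℚ K]
    (φ : K →+* ℂ) (c : K →₀ ℤ) (hc : c 0 ≠ 0)
    (hinv : ∀ (σ : K ≃ₐ[ℚ] K) (x : K), c (σ x) = c x) :
    ∑ x ∈ c.support, (c x : ℂ) * Complex.exp (φ x) ≠ 0 := by
  classical
  intro hsum
  set T : Finset K := c.support.erase 0 with hT
  have hsum' : (c 0 : ℂ) + ∑ x ∈ T, (c x : ℂ) * Complex.exp (φ x) = 0 := by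
    rw [← hsum, ← Finset.add_sum_erase _ _ (Finsupp.mem_support_iff.mpr hc)]
    simp [hT]
  have hT0 : ∀ x ∈ T, x ≠ 0 := fun x hx => (Finset.mem_erase.mp hx).1
  have hTσ (σ : K ≃ₐ[ℚ] K) (x : K) : σ x ∈ T ↔ x ∈ T := by
    simp [hT, hinv]
  obtain ⟨f, hf0, hf⟩ := exists_int_polynomial_forall_aeval_eq_zero T hT0
  obtain ⟨N, hN0, hN⟩ := exists_integral_multiples ℤ ℚ T
  obtain ⟨C, hC⟩ := LindemannWeierstrass.exp_polynomial_approx f hf0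
  have hroot : ∀ x ∈ T, φ x ∈ f.aroots ℂ := by
    intro x hx
    rw [mem_aroots]
    refine ⟨fun h => hf0 (by simp [h]), ?_⟩
    have := hom_eval₂ f (algebraMap ℤ K) φ x
    rw [← aeval_def, hf x hx, map_zero] at this
    rw [aeval_def, this]
    congr 1
    exact RingHom.ext_int _ _
  set D := f.natDegree
  set B : ℝ := ∑ x ∈ T, |(c x : ℝ)| with hB
  obtain ⟨n₀, hn₀⟩ := Filter.eventually_atTop.mp
    (eventually_mul_pow_succ_div_factorial_lt_one B (|(N : ℝ)| ^ D * |C|))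
  obtain ⟨p, hp, hprime⟩ := Nat.exists_infinite_primes
    (n₀ + (eval 0 f).natAbs + N.natAbs + (c 0).natAbs + 1)
  obtain ⟨n, hn, g, hg, happrox⟩ := hC p (by omega) hprime
  set S : K := ∑ x ∈ T, (c x : K) * aeval x g with hS
  have hSint : IsIntegral ℤ ((N : K) ^ (p * D) * S) := by
    rw [hS, Finset.mul_sum]
    refine IsIntegral.sum _ fun x hx => ?_
    have h1 : IsIntegral ℤ ((N : K) ^ (p * D) * aeval x g) :=
      isIntegral_pow_mul_aeval (by simpa [zsmul_eq_mul] using hN x hx) g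
        (hg.trans (Nat.sub_le _ _))
    have h2 : IsIntegral ℤ (c x : K) := isIntegral_algebraMap (R := ℤ) (x := c x)
    have := h2.mul h1
    rwa [mul_left_comm] at this
  have hSfix (σ : K ≃ₐ[ℚ] K) : σ S = S := by
    rw [hS, map_sum]
    refine Finset.sum_bij (fun x _ => σ x) (fun x hx => (hTσ σ x).mpr hx)
      (fun x _ y _ h => σ.injective h)
      (fun y hy => ⟨σ.symm y, (hTσ σ _).mp (by simpa using hy), by simp⟩) fun x _ => ?_
    rw [hinv, map_mul, map_intCast]
    congr 1
    exact (aeval_algHom_apply ((σ : K →ₐ[ℚ] K).restrictScalars ℤ) x g).symm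
  obtain ⟨m, hm⟩ := exists_int_eq_of_isIntegral_of_fixed hSint
    (fun σ => by rw [map_mul, map_pow, map_intCast, hSfix])
  have hpp : Prime (p : ℤ) := Nat.prime_iff_prime_int.mp hprime
  have hsmall {a : ℤ} (ha : a ≠ 0) (hap : a.natAbs < p) : ¬ (p : ℤ) ∣ a := fun h =>
    absurd (Nat.le_of_dvd (Int.natAbs_pos.mpr ha) (Int.natCast_dvd.mp h)) (by omega)
  -- Modulo `p` only the constant term of the relation survives, and `p` divides none of its
  -- factors.
  have hne : N ^ (p * D) * (n * c 0) + p * m ≠ 0 := by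
    intro h
    have hdvd : (p : ℤ) ∣ N ^ (p * D) * (n * c 0) :=
      ⟨-m, by linear_combination h⟩
    rcases hpp.dvd_or_dvd hdvd with h | h
    · exact hsmall hN0 (by omega) (hpp.dvd_of_dvd_pow h)
    · rcases hpp.dvd_or_dvd h with h | h
      · exact hn h
      · exact hsmall hc (by omega) h
  have hφS : φ S = ∑ x ∈ T, (c x : ℂ) * aeval (φ x) g := by
    rw [hS, map_sum]
    refine Finset.sum_congr rfl fun x _ => ?_
    rw [map_mul, map_intCast]
    congr 1
    exact (aeval_algHom_apply φ.toIntAlgHom x g).symm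
  -- Scaling the relation by `n * N ^ (p * D)` turns this integer into minus the total approximation
  -- error.
  have hval : ((N ^ (p * D) * (n * c 0) + p * m : ℤ) : ℂ) =
      -((N : ℂ) ^ (p * D) *
        ∑ x ∈ T, (c x : ℂ) * (n • Complex.exp (φ x) - p • aeval (φ x) g)) := by
    have hm' : (m : ℂ) = (N : ℂ) ^ (p * D) * φ S := by
      rw [← map_intCast φ m, hm, map_mul, map_pow, map_intCast]
    have hsplit : ∑ x ∈ T, (c x : ℂ) * (n • Complex.exp (φ x) - p • aeval (φ x) g) =
        n * ∑ x ∈ T, (c x : ℂ) * Complex.exp (φ x) - p * φ S := by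
      rw [hφS, Finset.mul_sum, Finset.mul_sum, ← Finset.sum_sub_distrib]
      refine Finset.sum_congr rfl fun x _ => ?_
      rw [zsmul_eq_mul, nsmul_eq_mul]
      ring
    rw [hsplit]
    push_cast
    rw [hm']
    linear_combination (N : ℂ) ^ (p * D) * n * hsum'
  have hbound : ‖∑ x ∈ T, (c x : ℂ) * (n • Complex.exp (φ x) - p • aeval (φ x) g)‖ ≤
      B * (|C| ^ p / (p - 1).factorial) := by
    rw [hB, Finset.sum_mul]
    refine norm_sum_le_of_le _ fun x hx => ?_
    rw [norm_mul, Complex.norm_intCast]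
    gcongr
    refine (happrox (hroot x hx)).trans ?_
    rw [← abs_pow]
    gcongr
    exact le_abs_self _
  have hge : (1 : ℝ) ≤ ‖((N ^ (p * D) * (n * c 0) + p * m : ℤ) : ℂ)‖ := by
    rw [Complex.norm_intCast]
    exact_mod_cast Int.one_le_abs hne
  have hlt := hn₀ (p - 1) (by omega)
  rw [Nat.sub_add_cancel hprime.one_le] at hlt
  refine absurd (hge.trans_lt ?_) (lt_irrefl _)
  rw [hval, norm_neg, norm_mul, norm_pow, Complex.norm_intCast]
  calc |(N : ℝ)| ^ (p * D) * _ ≤ |(N : ℝ)| ^ (p * D) * (B * (|C| ^ p / (p - 1).factorial)) := by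
        gcongr
    _ = B * ((|(N : ℝ)| ^ D * |C|) ^ p / (p - 1).factorial) := by
        rw [mul_pow, ← pow_mul, mul_comm D p]
        ring
    _ < 1 := hlt

/-! ### Reduction to invariant relations -/

/-- The ring homomorphism sending the formal symbol of `x` to `exp (φ x)`. -/
noncomputable def AddMonoidAlgebra.expEval {K : Type*} [Field K] (φ : K →+* ℂ) :
    AddMonoidAlgebra ℤ K →ₐ[ℤ] ℂ :=
  AddMonoidAlgebra.lift ℤ ℂ K (Complex.expMonoidHom.comp φ.toAddMonoidHom.toMultiplicative)

theorem AddMonoidAlgebra.expEval_apply {K : Type*} [Field K] (φ : K →+* ℂ)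
    (F : AddMonoidAlgebra ℤ K) :
    expEval φ F = ∑ x ∈ F.coeff.support, (F.coeff x : ℂ) * Complex.exp (φ x) := by
  rw [expEval, AddMonoidAlgebra.lift_apply', Finsupp.sum]
  rfl

/-- The Lindemann–Weierstrass theorem for integer coefficients: exponentials of distinct algebraic
numbers are linearly independent over `ℤ`. -/
theorem AddMonoidAlgebra.expEval_ne_zero {K : Type*} [Field K] [NumberField K] [IsGalois ℚ K]
    (φ : K →+* ℂ) {F : AddMonoidAlgebra ℤ K} (hF : F ≠ 0) : expEval φ F ≠ 0 := by
  classical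
  intro h0
  let act (σ : K ≃ₐ[ℚ] K) : AddMonoidAlgebra ℤ K →+* AddMonoidAlgebra ℤ K :=
    mapDomainRingHom ℤ (σ : K →+ K)
  have hact_coeff (σ : K ≃ₐ[ℚ] K) (P : AddMonoidAlgebra ℤ K) (x : K) :
      (act σ P).coeff (σ x) = P.coeff x := Finsupp.mapDomain_apply σ.injective _ _
  have hact_inj (σ : K ≃ₐ[ℚ] K) : Function.Injective (act σ) :=
    mapDomain_injective σ.injective
  have hact_mul (σ τ : K ≃ₐ[ℚ] K) (P : AddMonoidAlgebra ℤ K) : act (σ * τ) P = act σ (act τ P) := by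
    ext x
    obtain ⟨y, rfl⟩ := (σ * τ).surjective x
    rw [hact_coeff]
    exact ((hact_coeff σ _ _).trans (hact_coeff τ _ _)).symm
  -- The product over all conjugates is invariant, and its factor at `σ = 1` keeps the evaluation
  -- zero.
  set P := ∏ σ : K ≃ₐ[ℚ] K, act σ F with hP
  have hP0 : P ≠ 0 := by
    rw [hP, Finset.prod_ne_zero_iff]
    exact fun σ _ => (map_ne_zero_iff _ (hact_inj σ)).mpr hF
  have hPinv (τ : K ≃ₐ[ℚ] K) : act τ P = P := by
    rw [hP, map_prod]
    simp_rw [← hact_mul]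
    exact Fintype.prod_equiv (Equiv.mulLeft τ) _ _ fun _ => rfl
  obtain ⟨x₀, hx₀⟩ : ∃ x, P.coeff x ≠ 0 := by
    by_contra! h
    exact hP0 (AddMonoidAlgebra.ext (Finsupp.ext h))
  -- This invariant factor moves the coefficients of `P` along the orbit of `x₀` to exponent 0; they
  -- are all equal, so they cannot cancel.
  set E : AddMonoidAlgebra ℤ K := ∑ σ : K ≃ₐ[ℚ] K, single (-(σ x₀)) 1 with hE
  have hEinv (τ : K ≃ₐ[ℚ] K) : act τ E = E := by
    rw [hE, map_sum]
    refine Fintype.sum_equiv (Equiv.mulLeft τ) _ _ fun σ => ?_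
    simp [act]
  have hPσ (σ : K ≃ₐ[ℚ] K) (x : K) : P.coeff (σ x) = P.coeff x := by
    conv_lhs => rw [← hPinv σ]
    exact hact_coeff σ P x
  have hPE0 : (P * E).coeff 0 ≠ 0 := by
    have : (P * E).coeff 0 = Fintype.card (K ≃ₐ[ℚ] K) * P.coeff x₀ := by
      rw [hE, Finset.mul_sum, coeff_sum, Finsupp.finsetSum_apply]
      simp [hPσ]
    rw [this]
    exact mul_ne_zero (by exact_mod_cast Fintype.card_ne_zero) hx₀
  refine sum_mul_exp_ne_zero_of_invariant φ (P * E).coeff hPE0 (fun σ x => ?_) ?_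
  · conv_lhs => rw [← hPinv σ, ← hEinv σ, ← map_mul]
    exact hact_coeff σ _ x
  · have hact_one : act 1 F = F := by
      ext x
      exact hact_coeff 1 F x
    rw [← expEval_apply, map_mul, hP, map_prod,
      Finset.prod_eq_zero (Finset.mem_univ 1) ((congrArg _ hact_one).trans h0), zero_mul]

open Polynomial in
/-- The **Hermite–Lindemann theorem**: the exponential of a nonzero algebraic number is
transcendental. -/
theorem Complex.transcendental_exp {b : ℂ} (hb : IsAlgebraic ℚ b) (hb0 : b ≠ 0) :
    Transcendental ℚ (Complex.exp b) := by
  let K := IntermediateField.adjoin ℚ ((minpoly ℚ b).rootSet ℂ)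
  have hsplit : (minpoly ℚ b).IsSplittingField ℚ K :=
    IntermediateField.adjoin_rootSet_isSplittingField (IsAlgClosed.splits _)
  have hfin : FiniteDimensional ℚ K := IsSplittingField.finiteDimensional K (minpoly ℚ b)
  have : Normal ℚ K := Normal.of_isSplittingField (minpoly ℚ b)
  have : NumberField K := { }
  have : IsGalois ℚ K := ⟨⟩
  have hbK : b ∈ K := IntermediateField.subset_adjoin _ _
    (mem_rootSet.mpr ⟨minpoly.ne_zero hb.isIntegral, minpoly.aeval ℚ b⟩)
  let φ : K →+* ℂ := algebraMap K ℂ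
  let β : K := ⟨b, hbK⟩
  have hβ : β ≠ 0 := fun h => hb0 (congrArg Subtype.val h)
  intro halg
  obtain ⟨q, hq0, hq⟩ := (IsFractionRing.isAlgebraic_iff ℤ ℚ ℂ).mpr halg
  -- The multiples `k • β` are distinct, so no two terms of `q` merge.
  have hcoeff (k : ℕ) : (aeval (AddMonoidAlgebra.single β (1 : ℤ)) q).coeff (k • β) =
      q.coeff k := by
    rw [aeval_eq_sum_range, AddMonoidAlgebra.coeff_sum, Finsupp.finsetSum_apply]
    have hterm (i : ℕ) : (q.coeff i • AddMonoidAlgebra.single β (1 : ℤ) ^ i).coeff (k • β) =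
        if i = k then q.coeff i else 0 := by
      have hinj : i • β = k • β ↔ i = k := by simp [hβ]
      rw [AddMonoidAlgebra.single_pow, one_pow, AddMonoidAlgebra.coeff_smul_apply,
        AddMonoidAlgebra.coeff_single, Finsupp.single_apply]
      simp only [hinj, smul_eq_mul, mul_ite, mul_one, mul_zero]
    simp_rw [hterm]
    rw [Finset.sum_ite_eq', ite_eq_left_iff, Finset.mem_range]
    exact fun h => (coeff_eq_zero_of_natDegree_lt (by omega)).symm
  have hne : aeval (AddMonoidAlgebra.single β (1 : ℤ)) q ≠ 0 := by
    intro h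
    refine hq0 (Polynomial.ext fun k => ?_)
    rw [← hcoeff, h]
    simp
  refine AddMonoidAlgebra.expEval_ne_zero φ hne ?_
  rw [← aeval_algHom_apply, ← hq]
  congr 1
  simp [AddMonoidAlgebra.expEval, φ, β]

/-! ### Transcendence for the listed functions -/

/-- An algebraic cosine forces an algebraic sine, hence an algebraic `exp (b * I)`. -/
theorem Complex.transcendental_cos {b : ℂ} (hb : IsAlgebraic ℚ b) (hb0 : b ≠ 0) :
    Transcendental ℚ (Complex.cos b) := by
  have hI : IsAlgebraic ℚ Complex.I := Complex.isIntegral_rat_I.isAlgebraic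
  intro hcos
  have hsin : IsAlgebraic ℚ (Complex.sin b) := by
    refine IsAlgebraic.of_pow two_pos ?_
    rw [Complex.sin_sq]
    exact isAlgebraic_one.sub (hcos.pow 2)
  refine Complex.transcendental_exp (hb.mul hI) (mul_ne_zero hb0 Complex.I_ne_zero) ?_
  rw [Complex.exp_mul_I]
  exact hcos.add (hsin.mul hI)

theorem Complex.transcendental_sin {b : ℂ} (hb : IsAlgebraic ℚ b) (hb0 : b ≠ 0) :
    Transcendental ℚ (Complex.sin b) := by
  intro hsin
  refine Complex.transcendental_cos hb hb0 (IsAlgebraic.of_pow two_pos ?_)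
  rw [Complex.cos_sq']
  exact isAlgebraic_one.sub (hsin.pow 2)

/-- The tangent of a nonzero algebraic number is transcendental. Such a number is not a pole, as
its cosine is transcendental. -/
theorem Complex.transcendental_tan {b : ℂ} (hb : IsAlgebraic ℚ b) (hb0 : b ≠ 0) :
    Transcendental ℚ (Complex.tan b) := by
  intro htan
  have hcos : Complex.cos b ≠ 0 := fun h =>
    Complex.transcendental_cos hb hb0 (h ▸ isAlgebraic_zero)
  refine Complex.transcendental_cos hb hb0 (IsAlgebraic.of_pow two_pos ?_)
  rw [← Complex.inv_one_add_tan_sq hcos]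
  exact (isAlgebraic_one.add (htan.pow 2)).inv

theorem Transcendental.inv {z : ℂ} (hz : Transcendental ℚ z) : Transcendental ℚ z⁻¹ :=
  fun h => hz (inv_inv z ▸ h.inv)

/-- A listed function takes transcendental values at nonzero algebraic numbers, except for zeros of
the logarithm. -/
theorem IsListedFunction.transcendental_apply {f : ℂ → ℂ} (hf : IsListedFunction f) {b : ℂ}
    (hb : IsAlgebraic ℚ b) (hb0 : b ≠ 0) (hfb : f b ≠ 0) : Transcendental ℚ (f b) := by
  have hI : IsAlgebraic ℚ Complex.I := Complex.isIntegral_rat_I.isAlgebraic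
  have hbI : IsAlgebraic ℚ (b * Complex.I) := hb.mul hI
  have hbI0 : b * Complex.I ≠ 0 := mul_ne_zero hb0 Complex.I_ne_zero
  have htanh : Transcendental ℚ (Complex.tanh b) := by
    intro h
    refine Complex.transcendental_tan hbI hbI0 ?_
    rw [Complex.tan_mul_I]
    exact h.mul hI
  cases hf with
  | ln L hL => exact fun h => Complex.transcendental_exp h hfb (by rwa [hL b hb0])
  | sin => exact Complex.transcendental_sin hb hb0
  | cos => exact Complex.transcendental_cos hb hb0
  | tan => exact Complex.transcendental_tan hb hb0
  | csc =>
    rw [cscFun, one_div]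
    exact (Complex.transcendental_sin hb hb0).inv
  | sec =>
    rw [secFun, one_div]
    exact (Complex.transcendental_cos hb hb0).inv
  | cot =>
    rw [← Complex.tan_inv_eq_cot]
    exact (Complex.transcendental_tan hb hb0).inv
  | sinh =>
    intro h
    refine Complex.transcendental_sin hbI hbI0 ?_
    rw [Complex.sin_mul_I]
    exact h.mul hI
  | cosh =>
    rw [← Complex.cos_mul_I]
    exact Complex.transcendental_cos hbI hbI0
  | tanh => exact htanh
  | coth =>
    rw [cothFun, ← inv_div, ← Complex.tanh_eq_sinh_div_cosh]
    exact htanh.inv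

theorem corollary2 (f : ℂ → ℂ) (hf : IsListedFunction f)
    (g h₁ h₂ : Polynomial ℚ) (α : ℂ) (hα : α ≠ 0)
    (hsol : Polynomial.aeval α h₁ * f (Polynomial.aeval α g) = Polynomial.aeval α h₂)
    (hh₁ : Polynomial.aeval α h₁ ≠ 0) (hg : Polynomial.aeval α g ≠ 0)
    (hfg : f (Polynomial.aeval α g) ≠ 0) (hh₂ : Polynomial.aeval α h₂ ≠ 0) :
    Transcendental ℚ α := by
  intro hα_alg
  have hpoly (P : Polynomial ℚ) : IsAlgebraic ℚ (Polynomial.aeval α P) :=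
    not_not.mp fun h => (transcendental_aeval_iff.mp h).1 hα_alg
  refine hf.transcendental_apply (hpoly g) hg hfg ?_
  rw [eq_div_of_mul_eq hh₁ ((mul_comm _ _).trans hsol), div_eq_mul_inv]
  exact (hpoly h₂).mul (hpoly h₁).inv
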